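/- **Setting.** Fix a budget $T\in\mathbb{N}$ and a tolerance $0<\eta\le 1/4$. An environment $v$ has a mean reward function $f(x)=\mu_1\mathbf 1\{x\le x^*_v\}+\mu_2\mathbf 1\{x>x^*_v\}$ on $[0,1]$ with $\mu_1\ne\mu_2$ real and one change point $x^*_v\in[0,1)$. In each round $t=1,\dots,T$ a learner chooses an action $x_t\in[0,1]$, possibly at random, on the basis of the previous actions and rewards, and receives $y_t=f(x_t)+\epsilon_t$ with i.i.d. noise $\epsilon_t$. After $T$ rounds it returns an estimate $\hat x_T$ of the change point that depends (possibly at random) on the observed history. Let $\Pi$ be the set of all such policies, let $\mathbb P_{v,\pi}$ be the law of the interaction of $\pi\in\Pi$ with $v$, and let $F_{T,v,\eta}=\{|\hat x_T-x^*_v|\ge\eta\}$ be the failure event. **Theorem.** Let $\Delta>0$ and $\sigma>0$, and let $\bar V$ be the set of environments with $|\mu_1-\mu_2|=\Delta$, with Gaussian noise of mean zero and variance $\sigma^2$, and with any change point in $[0,1)$. If $$T\ \ge\ T_1:=\frac{\sigma^2}{\Delta^2}\Bigl(1.59\,\log\Bigl\lfloor\frac1{2\eta}\Bigr\rfloor-2\log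 2\Bigr),$$ then $$\inf_{\pi\in\Pi}\ \sup_{v\in\bar V}\ \mathbb P_{v,\pi}\bigl(F_{T,v,\eta}\bigr)\ \ge\ \frac18\exp\Bigl[-\frac{\Delta^2}{2\sigma^2}\,T+\frac12\log\Bigl(\frac12\Bigl(\Bigl\lfloor\frac1{2\eta}\Bigr\rfloor-1\Bigr)\Bigr)\Bigr].$$ -/

import Mathlib

open MeasureTheory ProbabilityTheory
open scoped NNReal ENNReal

namespace PiecewiseConstantBandit

/-- The action space `[0, 1]`. -/
abbrev Action : Type := Set.Icc (0 : ℝ) 1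

/-- An environment: two different mean rewards, one change point in `[0, 1)`, and the common law of
the i.i.d. noise variables. -/
structure Environment where
  /-- mean reward up to and including the change point -/
  mean₁ : ℝ
  /-- mean reward after the change point -/
  mean₂ : ℝ
  mean_ne : mean₁ ≠ mean₂
  /-- the change point -/
  changePoint : ℝ
  changePoint_mem : changePoint ∈ Set.Ico (0 : ℝ) 1
  /-- the law of the noise -/
  noise : Measure ℝ
  noise_prob : IsProbabilityMeasure noise

namespace Environment

/-- The mean reward function `f(x) = μ₁ 1{x ≤ x*} + μ₂ 1{x > x*}`. -/
noncomputable def meanReward (v : Environment) (x : Action) : ℝ :=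
  if (x : ℝ) ≤ v.changePoint then v.mean₁ else v.mean₂

theorem measurable_meanReward (v : Environment) : Measurable v.meanReward :=
  Measurable.ite (measurableSet_le measurable_subtype_coe measurable_const)
    measurable_const measurable_const

/-- The law of the reward `f(x) + ε` received when the action `x` is played. -/
noncomputable def rewardKernel (v : Environment) : Kernel Action ℝ where
  toFun x := v.noise.map (fun ε => v.meanReward x + ε)
  measurable' := by
    have := v.noise_prob
    refine Measure.measurable_of_measurable_coe _ fun s hs => ?_
    have hm : Measurable fun p : Action × ℝ => v.meanReward p.1 + p.2 :=
      (v.measurable_meanReward.comp measurable_fst).add measurable_snd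
    have h := measurable_measure_prodMk_left (ν := v.noise) (hm hs)
    convert h using 2 with x
    exact Measure.map_apply (measurable_const_add _) hs

end Environment

/-- `V(Δ, σ)`: change in mean `Δ` and mean-zero `σ²`-sub-Gaussian noise, any change point. -/
def subGaussianEnvironments (Δ : ℝ) (σ : ℝ≥0) : Set Environment :=
  {v | |v.mean₁ - v.mean₂| = Δ ∧ ∫ ε, ε ∂v.noise = 0 ∧ HasSubgaussianMGF id (σ ^ 2) v.noise}

/-- The environments of `V(Δ, σ)` whose noise is Gaussian with mean zero and variance `σ²`. -/
def gaussianEnvironments (Δ : ℝ) (σ : ℝ≥0) : Set Environment :=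
  {v ∈ subGaussianEnvironments Δ σ | v.noise = gaussianReal 0 (σ ^ 2)}

/-- Histories of `t` rounds: a history of `t + 1` rounds is a history of `t` rounds followed by the
action and the reward of the last round. -/
def History : ℕ → Type
  | 0 => Unit
  | t + 1 => History t × (Action × ℝ)

/-- The product σ-algebra on histories. -/
instance History.instMeasurableSpace : (t : ℕ) → MeasurableSpace (History t)
  | 0 => inferInstanceAs (MeasurableSpace Unit)
  | t + 1 =>
    @Prod.instMeasurableSpace (History t) (Action × ℝ) (History.instMeasurableSpace t) inferInstance

/-- A (possibly randomized) policy with budget `T`: the law of the next action given the history of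
the first `t` rounds (only `t < T` matters), and the law of the estimate of the change point given
the history of all `T` rounds. -/
structure Policy (T : ℕ) where
  act : (t : ℕ) → Kernel (History t) Action
  act_markov : ∀ t, IsMarkovKernel (act t)
  estimate : Kernel (History T) ℝ
  estimate_markov : IsMarkovKernel estimate

namespace Policy

/-- The law of the history of the first `t` rounds when the policy interacts with `v`. -/
noncomputable def historyLaw {T : ℕ} (π : Policy T) (v : Environment) :
    (t : ℕ) → Measure (History t)
  | 0 => Measure.dirac ()
  | t + 1 => (π.historyLaw v t) ⊗ₘ (π.act t ⊗ₖ Kernel.prodMkLeft (History t) v.rewardKernel)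

/-- The law of the estimate `x̂_T` when the policy interacts with `v`. -/
noncomputable def estimateLaw {T : ℕ} (π : Policy T) (v : Environment) : Measure ℝ :=
  (π.historyLaw v T).bind π.estimate

/-- The probability `ℙ_{π,v}(|x̂_T - x*_v| ≥ η)` of failure. -/
noncomputable def failureProb {T : ℕ} (π : Policy T) (v : Environment) (η : ℝ) : ℝ≥0∞ :=
  π.estimateLaw v {x | η ≤ |x - v.changePoint|}

end Policy

/-- The budget threshold `T₁ = (σ²/Δ²) (1.59 log ⌊1/(2η)⌋ - 2 log 2)`. -/
noncomputable def budgetThreshold (Δ : ℝ) (σ : ℝ≥0) (η : ℝ) : ℝ :=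
  (σ : ℝ) ^ 2 / Δ ^ 2 * (1.59 * Real.log (⌊1 / (2 * η)⌋₊ : ℝ) - 2 * Real.log 2)

end PiecewiseConstantBandit

/-! Let `m = ⌊1/(2η)⌋`, and suppose that a policy fails with probability at most `E` in every
environment. The balls of radius `η` around `2ηj`, `1 ≤ j < m`, are disjoint and avoid the ball
around `0`. So when the change point is `0` they all lie in the failure event, and some ball `B` has
mass at most `E / (m - 1)` (`exists_mul_measure_ball_le`). When the change point is the centre of
that `B`, it is `Bᶜ` that has mass at most `E`.

These two bounds conflict if the two laws are close. Closeness is measured by the affinity `∫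
(dP_w/dP_v)^θ dP_v`. Each round contributes a factor of at least `exp(-θ(1-θ)Δ²/(2σ²))` whatever the
action, so adaptivity does not help (`le_lintegral_likelihoodRatio_rpow`). Hölder's inequality
bounds the affinity by the masses of `B` and `Bᶜ` (`exp_pow_le_estimateLaw_rpow`).

With `θ = 2/3` and `D = Δ²T/(2σ²)` this gives `exp(-2D/9) ≤ (E/(m-1))^(1/3) + E^(2/3)`, which fails
for `E` below the claimed bound (`rpow_add_rpow_lt_exp`). -/

namespace PiecewiseConstantBandit

/-! ### Gaussian change of measure and its affinities -/

section GaussianLikelihoodRatio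

/-- The density of `gaussianReal m' s` with respect to `gaussianReal m s`. -/
noncomputable def gaussianRatio (s : ℝ≥0) (m m' y : ℝ) : ℝ≥0∞ :=
  ENNReal.ofReal (Real.exp ((m' - m) / s * (y - m) - (m' - m) ^ 2 / (2 * s)))

@[fun_prop]
theorem measurable_gaussianRatio {α : Type*} [MeasurableSpace α] {s : ℝ≥0} {f g h : α → ℝ}
    (hf : Measurable f) (hg : Measurable g) (hh : Measurable h) :
    Measurable fun x => gaussianRatio s (f x) (g x) (h x) := by
  unfold gaussianRatio
  fun_prop

theorem gaussianPDF_mul_gaussianRatio {s : ℝ≥0} (hs : s ≠ 0) (m m' y : ℝ) :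
    gaussianPDF m s y * gaussianRatio s m m' y = gaussianPDF m' s y := by
  have hs' : (s : ℝ) ≠ 0 := by exact_mod_cast hs
  rw [gaussianPDF, gaussianRatio, ← ENNReal.ofReal_mul (gaussianPDFReal_nonneg _ _ _), gaussianPDF,
    gaussianPDFReal, gaussianPDFReal, mul_assoc, ← Real.exp_add]
  congr 3
  field_simp
  ring

theorem lintegral_gaussianReal_eq {s : ℝ≥0} (hs : s ≠ 0) (m m' : ℝ) {f : ℝ → ℝ≥0∞}
    (hf : Measurable f) :
    ∫⁻ y, f y ∂gaussianReal m' s = ∫⁻ y, gaussianRatio s m m' y * f y ∂gaussianReal m s := by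
  have hr : Measurable fun y => gaussianRatio s m m' y := by fun_prop
  rw [gaussianReal_of_var_ne_zero _ hs, gaussianReal_of_var_ne_zero _ hs,
    lintegral_withDensity_eq_lintegral_mul _ (measurable_gaussianPDF _ _) hf,
    lintegral_withDensity_eq_lintegral_mul _ (measurable_gaussianPDF _ _)
      (g := fun y => gaussianRatio s m m' y * f y) (hr.mul hf)]
  refine lintegral_congr fun y => ?_
  simp only [Pi.mul_apply]
  rw [← mul_assoc, gaussianPDF_mul_gaussianRatio hs]

/-- A power of the ratio is the exponential of an affine function of `y`, so the integral is a value
of the Gaussian moment generating function. -/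
theorem lintegral_gaussianRatio_rpow {s : ℝ≥0} (hs : s ≠ 0) (m m' θ : ℝ) :
    ∫⁻ y, gaussianRatio s m m' y ^ θ ∂gaussianReal m s =
      ENNReal.ofReal (Real.exp (-(θ * (1 - θ)) * ((m' - m) ^ 2 / (2 * s)))) := by
  have hs' : (s : ℝ) ≠ 0 := by exact_mod_cast hs
  set a : ℝ := θ * ((m' - m) / s) with ha
  set b : ℝ := -a * m - θ * ((m' - m) ^ 2 / (2 * s)) with hb
  have h : ∀ y, gaussianRatio s m m' y ^ θ = ENNReal.ofReal (Real.exp (a * y) * Real.exp b) := by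
    intro y
    rw [gaussianRatio, ENNReal.ofReal_rpow_of_pos (Real.exp_pos _), ← Real.exp_mul, ← Real.exp_add]
    congr 2
    rw [hb, ha]
    ring
  simp_rw [h]
  rw [← ofReal_integral_eq_lintegral_ofReal ((integrable_exp_mul_gaussianReal a).mul_const _)
    (ae_of_all _ fun y => by positivity), integral_mul_const]
  have hmgf := congrFun (mgf_id_gaussianReal (μ := m) (v := s)) a
  simp only [mgf, id] at hmgf
  rw [hmgf, ← Real.exp_add]
  congr 2
  rw [hb, ha]
  field_simp
  ring

end GaussianLikelihoodRatio

theorem Environment.rewardKernel_eq_gaussianReal {v : Environment} {s : ℝ≥0}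
    (hv : v.noise = gaussianReal 0 s) (x : Action) :
    v.rewardKernel x = gaussianReal (v.meanReward x) s := by
  change v.noise.map (fun ε => v.meanReward x + ε) = _
  rw [hv, gaussianReal_map_const_add, zero_add]

instance (v : Environment) : IsMarkovKernel v.rewardKernel where
  isProbabilityMeasure x := by
    have := v.noise_prob
    exact Measure.isProbabilityMeasure_map (μ := v.noise)
      (f := fun ε => v.meanReward x + ε) (by fun_prop)

/-! ### Likelihood ratios and affinities of interaction laws -/

namespace Policy

variable {T : ℕ} (π : Policy T)

instance (t : ℕ) : IsMarkovKernel (π.act t) := π.act_markov t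

instance : IsMarkovKernel π.estimate := π.estimate_markov

instance (v : Environment) (t : ℕ) : IsProbabilityMeasure (π.historyLaw v t) := by
  induction t with
  | zero => exact inferInstanceAs (IsProbabilityMeasure (Measure.dirac ()))
  | succ t ih =>
    exact inferInstanceAs (IsProbabilityMeasure ((π.historyLaw v t) ⊗ₘ
      (π.act t ⊗ₖ Kernel.prodMkLeft (History t) v.rewardKernel)))

/-- The law of the action and the reward of round `t + 1` given the history of `t` rounds. -/
noncomputable def stepKernel (v : Environment) (t : ℕ) : Kernel (History t) (Action × ℝ) :=
  π.act t ⊗ₖ Kernel.prodMkLeft (History t) v.rewardKernel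

instance (v : Environment) (t : ℕ) : IsMarkovKernel (π.stepKernel v t) := by
  unfold stepKernel
  infer_instance

theorem lintegral_stepKernel (v : Environment) (t : ℕ) (h : History t)
    {g : Action × ℝ → ℝ≥0∞} (hg : Measurable g) :
    ∫⁻ p, g p ∂(π.stepKernel v t h) =
      ∫⁻ a, ∫⁻ y, g (a, y) ∂(v.rewardKernel a) ∂(π.act t h) := by
  rw [stepKernel, Kernel.lintegral_compProd _ _ _ hg]
  rfl

theorem lintegral_historyLaw_succ (v : Environment) (t : ℕ)
    {f : History t × (Action × ℝ) → ℝ≥0∞} (hf : Measurable f) :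
    ∫⁻ h, f h ∂(π.historyLaw v (t + 1)) =
      ∫⁻ h, ∫⁻ p, f (h, p) ∂(π.stepKernel v t h) ∂(π.historyLaw v t) :=
  Measure.lintegral_compProd (μ := π.historyLaw v t) (κ := π.stepKernel v t) hf

/-- The likelihood ratio of a history between the environments `w` and `v` with Gaussian noise of
variance `s`. -/
noncomputable def likelihoodRatio (s : ℝ≥0) (v w : Environment) : (t : ℕ) → History t → ℝ≥0∞
  | 0, _ => 1
  | t + 1, h => likelihoodRatio s v w t h.1 *
      gaussianRatio s (v.meanReward h.2.1) (w.meanReward h.2.1) h.2.2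

theorem measurable_gaussianRatio_meanReward (s : ℝ≥0) (v w : Environment) :
    Measurable fun p : Action × ℝ =>
      gaussianRatio s (v.meanReward p.1) (w.meanReward p.1) p.2 := by
  have hv := v.measurable_meanReward
  have hw := w.measurable_meanReward
  exact measurable_gaussianRatio (hv.comp measurable_fst) (hw.comp measurable_fst) measurable_snd

theorem measurable_likelihoodRatio (s : ℝ≥0) (v w : Environment) (t : ℕ) :
    Measurable (likelihoodRatio s v w t) := by
  induction t with
  | zero => exact measurable_const
  | succ t ih =>
    exact Measurable.mul (M := ℝ≥0∞) (α := History t × (Action × ℝ))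
      (f := fun h => likelihoodRatio s v w t h.1) (ih.comp measurable_fst)
      ((measurable_gaussianRatio_meanReward s v w).comp measurable_snd)

variable {s : ℝ≥0} {v w : Environment}

theorem lintegral_stepKernel_eq (hs : s ≠ 0) (hv : v.noise = gaussianReal 0 s)
    (hw : w.noise = gaussianReal 0 s) (t : ℕ) (h : History t) {g : Action × ℝ → ℝ≥0∞}
    (hg : Measurable g) :
    ∫⁻ p, g p ∂(π.stepKernel w t h) =
      ∫⁻ p, gaussianRatio s (v.meanReward p.1) (w.meanReward p.1) p.2 * g p
        ∂(π.stepKernel v t h) := by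
  rw [π.lintegral_stepKernel w t h hg, π.lintegral_stepKernel v t h
    (g := fun p => gaussianRatio s (v.meanReward p.1) (w.meanReward p.1) p.2 * g p)
    ((measurable_gaussianRatio_meanReward s v w).mul hg)]
  refine lintegral_congr fun a => ?_
  rw [Environment.rewardKernel_eq_gaussianReal hv, Environment.rewardKernel_eq_gaussianReal hw]
  exact lintegral_gaussianReal_eq hs _ _ (hg.comp measurable_prodMk_left)

/-- Both environments face the same action kernels, which cancel; only the reward densities remain
in the ratio. -/
theorem lintegral_historyLaw_eq (hs : s ≠ 0) (hv : v.noise = gaussianReal 0 s)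
    (hw : w.noise = gaussianReal 0 s) (t : ℕ) {f : History t → ℝ≥0∞} (hf : Measurable f) :
    ∫⁻ h, f h ∂(π.historyLaw w t) =
      ∫⁻ h, likelihoodRatio s v w t h * f h ∂(π.historyLaw v t) := by
  induction t with
  | zero =>
    simp only [likelihoodRatio, one_mul]
    rfl
  | succ t ih =>
    have hLf : Measurable fun h : History (t + 1) => likelihoodRatio s v w (t + 1) h * f h :=
      (measurable_likelihoodRatio s v w (t + 1)).mul hf
    rw [π.lintegral_historyLaw_succ w t hf, ih (f := fun h => ∫⁻ p, f (h, p) ∂π.stepKernel w t h)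
        (Measurable.lintegral_kernel_prod_right' hf)]
    refine Eq.trans ?_ (π.lintegral_historyLaw_succ v t hLf).symm
    refine lintegral_congr fun h => ?_
    have hfh : Measurable fun p : Action × ℝ => f (h, p) :=
      Measurable.comp (g := f) hf measurable_prodMk_left
    rw [π.lintegral_stepKernel_eq hs hv hw t h hfh]
    refine (lintegral_const_mul (likelihoodRatio s v w t h)
      ((measurable_gaussianRatio_meanReward s v w).mul hfh)).symm.trans ?_
    refine lintegral_congr fun p => ?_
    rw [Pi.mul_apply]
    simp only [likelihoodRatio]
    rw [mul_assoc]

theorem le_lintegral_gaussianRatio_rpow_stepKernel (hs : s ≠ 0) (hv : v.noise = gaussianReal 0 s)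
    {δ θ : ℝ} (hθ₀ : 0 ≤ θ) (hθ₁ : θ ≤ 1)
    (hδ : ∀ x, (w.meanReward x - v.meanReward x) ^ 2 ≤ δ ^ 2) (t : ℕ) (h : History t) :
    ENNReal.ofReal (Real.exp (-(θ * (1 - θ)) * (δ ^ 2 / (2 * s)))) ≤
      ∫⁻ p, gaussianRatio s (v.meanReward p.1) (w.meanReward p.1) p.2 ^ θ
        ∂(π.stepKernel v t h) := by
  rw [π.lintegral_stepKernel v t h ((measurable_gaussianRatio_meanReward s v w).pow_const θ)]
  calc _ = ∫⁻ _, ENNReal.ofReal (Real.exp (-(θ * (1 - θ)) * (δ ^ 2 / (2 * s)))) ∂(π.act t h) := by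
        simp
    _ ≤ _ := lintegral_mono fun a => ?_
  rw [Environment.rewardKernel_eq_gaussianReal hv]
  refine le_of_le_of_eq ?_
    (lintegral_gaussianRatio_rpow hs (v.meanReward a) (w.meanReward a) θ).symm
  refine ENNReal.ofReal_le_ofReal (Real.exp_le_exp.2 ?_)
  have h1 : 0 ≤ θ * (1 - θ) := mul_nonneg hθ₀ (by linarith)
  have h2 : (w.meanReward a - v.meanReward a) ^ 2 / (2 * s) ≤ δ ^ 2 / (2 * s) :=
    div_le_div_of_nonneg_right (hδ a) (by positivity)
  nlinarith

theorem le_lintegral_likelihoodRatio_rpow (hs : s ≠ 0) (hv : v.noise = gaussianReal 0 s)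
    {δ θ : ℝ} (hθ₀ : 0 ≤ θ) (hθ₁ : θ ≤ 1)
    (hδ : ∀ x, (w.meanReward x - v.meanReward x) ^ 2 ≤ δ ^ 2) (t : ℕ) :
    ENNReal.ofReal (Real.exp (-(θ * (1 - θ)) * (δ ^ 2 / (2 * s)))) ^ t ≤
      ∫⁻ h, likelihoodRatio s v w t h ^ θ ∂(π.historyLaw v t) := by
  induction t with
  | zero => simp [likelihoodRatio]
  | succ t ih =>
    rw [π.lintegral_historyLaw_succ v t
      ((measurable_likelihoodRatio s v w (t + 1)).pow_const θ), pow_succ]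
    refine (mul_le_mul_left ih _).trans ?_
    rw [← lintegral_mul_const _ ((measurable_likelihoodRatio s v w t).pow_const θ)]
    refine lintegral_mono fun h => ?_
    simp only [likelihoodRatio, ENNReal.mul_rpow_of_nonneg _ _ hθ₀]
    rw [lintegral_const_mul _ ((measurable_gaussianRatio_meanReward s v w).pow_const θ)]
    gcongr
    exact π.le_lintegral_gaussianRatio_rpow_stepKernel hs hv hθ₀ hθ₁ hδ t h

instance : IsProbabilityMeasure (π.estimateLaw v) := by
  unfold estimateLaw
  infer_instance

theorem estimateLaw_apply (v : Environment) {B : Set ℝ} (hB : MeasurableSet B) :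
    π.estimateLaw v B = ∫⁻ h, π.estimate h B ∂(π.historyLaw v T) :=
  Measure.bind_apply hB π.estimate.measurable.aemeasurable

/-- With `κ = π.estimate h B`, write `L^θ κ = (Lκ)^θ κ^(1-θ)` and apply Hölder; the integral of `Lκ`
under `v` is the mass of `B` under `w`. Keeping `κ` as a weight covers randomized estimates. -/
theorem lintegral_likelihoodRatio_rpow_mul_estimate_le (hs : s ≠ 0)
    (hv : v.noise = gaussianReal 0 s) (hw : w.noise = gaussianReal 0 s) {θ : ℝ}
    (hθ₀ : 0 ≤ θ) (hθ₁ : θ ≤ 1) {B : Set ℝ} (hB : MeasurableSet B) :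
    ∫⁻ h, likelihoodRatio s v w T h ^ θ * π.estimate h B ∂(π.historyLaw v T) ≤
      π.estimateLaw w B ^ θ * π.estimateLaw v B ^ (1 - θ) := by
  have hκ : Measurable fun h => π.estimate h B := π.estimate.measurable_coe hB
  have hL := measurable_likelihoodRatio s v w T
  rw [π.estimateLaw_apply w hB, π.estimateLaw_apply v hB, π.lintegral_historyLaw_eq hs hv hw T hκ]
  refine le_trans (le_of_eq (lintegral_congr fun h => ?_))
    (ENNReal.lintegral_mul_norm_pow_le (hL.mul hκ).aemeasurable hκ.aemeasurable hθ₀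
      (sub_nonneg.2 hθ₁) (add_sub_cancel _ _))
  rw [Pi.mul_apply, ENNReal.mul_rpow_of_nonneg _ _ hθ₀, mul_assoc,
    ← ENNReal.rpow_add_of_nonneg _ _ hθ₀ (sub_nonneg.2 hθ₁), add_sub_cancel, ENNReal.rpow_one]

/-- A lower bound on the two error probabilities of any test between two environments with Gaussian
noise, through the affinity of order `θ` of the two laws of the interaction. -/
theorem exp_pow_le_estimateLaw_rpow (hs : s ≠ 0) (hv : v.noise = gaussianReal 0 s)
    (hw : w.noise = gaussianReal 0 s) {δ θ : ℝ} (hθ₀ : 0 ≤ θ) (hθ₁ : θ ≤ 1)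
    (hδ : ∀ x, (w.meanReward x - v.meanReward x) ^ 2 ≤ δ ^ 2) {B : Set ℝ}
    (hB : MeasurableSet B) :
    ENNReal.ofReal (Real.exp (-(θ * (1 - θ)) * (δ ^ 2 / (2 * s)))) ^ T ≤
      π.estimateLaw w B ^ θ * π.estimateLaw v B ^ (1 - θ) +
        π.estimateLaw w Bᶜ ^ θ * π.estimateLaw v Bᶜ ^ (1 - θ) := by
  refine (π.le_lintegral_likelihoodRatio_rpow hs hv hθ₀ hθ₁ hδ T).trans ?_
  refine le_trans (le_of_eq ?_) (add_le_add
    (π.lintegral_likelihoodRatio_rpow_mul_estimate_le hs hv hw hθ₀ hθ₁ hB)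
    (π.lintegral_likelihoodRatio_rpow_mul_estimate_le hs hv hw hθ₀ hθ₁ hB.compl))
  rw [← lintegral_add_left (f := fun h => likelihoodRatio s v w T h ^ θ * π.estimate h B)
    (((measurable_likelihoodRatio s v w T).pow_const θ).mul (π.estimate.measurable_coe hB))]
  refine lintegral_congr fun h => ?_
  rw [← mul_add, prob_add_prob_compl hB, mul_one]

end Policy

/-! ### The separated change points and the reduction to testing -/

section HardEnvironments

/-- The environment with mean rewards `0` and `Δ` around the change point `x` and Gaussian noise
of variance `s`. -/
noncomputable def stepEnvironment (Δ : ℝ) (hΔ : 0 < Δ) (s : ℝ≥0) (x : ℝ)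
    (hx : x ∈ Set.Ico (0 : ℝ) 1) : Environment where
  mean₁ := 0
  mean₂ := Δ
  mean_ne := hΔ.ne
  changePoint := x
  changePoint_mem := hx
  noise := gaussianReal 0 s
  noise_prob := inferInstance

theorem stepEnvironment_mem {Δ : ℝ} (hΔ : 0 < Δ) (σ : ℝ≥0) {x : ℝ}
    (hx : x ∈ Set.Ico (0 : ℝ) 1) :
    stepEnvironment Δ hΔ (σ ^ 2) x hx ∈ gaussianEnvironments Δ σ := by
  refine ⟨⟨?_, ?_, ?_⟩, rfl⟩
  · simp [stepEnvironment, abs_of_pos hΔ]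
  · exact integral_id_gaussianReal
  · refine ⟨fun t => integrable_exp_mul_gaussianReal t, fun t => ?_⟩
    change mgf id (gaussianReal 0 (σ ^ 2)) t ≤ _
    rw [mgf_id_gaussianReal]
    simp

theorem sq_meanReward_sub_stepEnvironment_le {Δ : ℝ} (hΔ : 0 < Δ) (s : ℝ≥0) {x y : ℝ}
    (hx : x ∈ Set.Ico (0 : ℝ) 1) (hy : y ∈ Set.Ico (0 : ℝ) 1) (a : Action) :
    ((stepEnvironment Δ hΔ s x hx).meanReward a -
      (stepEnvironment Δ hΔ s y hy).meanReward a) ^ 2 ≤ Δ ^ 2 := by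
  simp only [Environment.meanReward, stepEnvironment]
  by_cases h₁ : (a : ℝ) ≤ x <;> by_cases h₂ : (a : ℝ) ≤ y <;> simp [h₁, h₂, sq_nonneg]

theorem exists_mul_measure_ball_le {μ : Measure ℝ} {η : ℝ} (hη : 0 < η) {m : ℕ} (hm : 2 ≤ m) :
    ∃ j ∈ Finset.Ico 1 m, (↑(m - 1) : ℝ≥0∞) * μ {x | |x - 2 * η * j| < η} ≤
      μ {x | η ≤ |x - 0|} := by
  set B : ℕ → Set ℝ := fun j => {x | |x - 2 * η * j| < η} with hB
  have hdisj : ∀ i j : ℕ, i < j → Disjoint (B i) (B j) := by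
    intro i j hij
    rw [Set.disjoint_left]
    intro x hx hx'
    simp only [hB, Set.mem_ofPred_eq, abs_lt] at hx hx'
    have : (i : ℝ) + 1 ≤ j := by exact_mod_cast hij
    nlinarith
  have hmeas : ∀ j, MeasurableSet (B j) := fun j =>
    measurableSet_lt (by fun_prop) measurable_const
  have hsub : (⋃ j ∈ Finset.Ico 1 m, B j) ⊆ {x | η ≤ |x - 0|} := by
    intro x hx
    simp only [Set.mem_iUnion] at hx
    obtain ⟨j, hj, hxj⟩ := hx
    by_contra hcon
    have h0 : x ∈ B 0 := by simpa [hB] using hcon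
    exact Set.disjoint_left.1 (hdisj 0 j (Finset.mem_Ico.1 hj).1) h0 hxj
  have hsum : ∑ j ∈ Finset.Ico 1 m, μ (B j) ≤ μ {x | η ≤ |x - 0|} := by
    rw [← measure_biUnion_finset _ fun j _ => hmeas j]
    · exact measure_mono hsub
    · intro i _ j _ hij
      rcases lt_or_gt_of_ne hij with h | h
      · exact hdisj i j h
      · exact (hdisj j i h).symm
  obtain ⟨j, hj, hmin⟩ := Finset.exists_min_image (Finset.Ico 1 m) (fun j => μ (B j))
    ⟨1, Finset.mem_Ico.2 ⟨le_rfl, by omega⟩⟩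
  refine ⟨j, hj, le_trans ?_ hsum⟩
  have := Finset.card_nsmul_le_sum (Finset.Ico 1 m) (fun j => μ (B j)) _ hmin
  simpa [nsmul_eq_mul] using this

/-- A bound on any failure probability `E` that a policy attains in all environments: the change
point `0` is tested against the least likely of the change points `2 η j` with `1 ≤ j < m`. -/
theorem exp_pow_le_of_failureProb_le {T : ℕ} (π : Policy T) {Δ η : ℝ} {σ : ℝ≥0} (hΔ : 0 < Δ)
    (hσ : 0 < σ) (hη : 0 < η) {m : ℕ} (hm : 2 ≤ m) (hm' : (m : ℝ) * (2 * η) ≤ 1) {E : ℝ≥0∞}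
    (hE : ∀ v ∈ gaussianEnvironments Δ σ, π.failureProb v η ≤ E) :
    ENNReal.ofReal (Real.exp (-(1 / 9) * (Δ ^ 2 / (σ : ℝ) ^ 2))) ^ T ≤
      (E / ↑(m - 1)) ^ (1 / 3 : ℝ) + E ^ (2 / 3 : ℝ) := by
  have h0 : (0 : ℝ) ∈ Set.Ico (0 : ℝ) 1 := by simp
  set v := stepEnvironment Δ hΔ (σ ^ 2) 0 h0 with hv
  obtain ⟨j, hj, hle⟩ := exists_mul_measure_ball_le (μ := π.estimateLaw v) hη hm
  rw [Finset.mem_Ico] at hj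
  -- Stopping at `j < m` keeps the change point strictly below `1`.
  have hx : 2 * η * j ∈ Set.Ico (0 : ℝ) 1 := by
    refine ⟨by positivity, lt_of_lt_of_le ?_ hm'⟩
    have : (j : ℝ) < m := by exact_mod_cast hj.2
    nlinarith
  set w := stepEnvironment Δ hΔ (σ ^ 2) (2 * η * j) hx with hw
  set B : Set ℝ := {x | |x - 2 * η * j| < η} with hBdef
  have hB : MeasurableSet B := measurableSet_lt (by fun_prop) measurable_const
  have hBc : Bᶜ = {x | η ≤ |x - w.changePoint|} := by
    ext x
    simp [hBdef, hw, stepEnvironment]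
  have hvB : π.estimateLaw v B ≤ E / ↑(m - 1) := by
    rw [ENNReal.le_div_iff_mul_le (Or.inl (Nat.cast_ne_zero.2 (by omega))) (Or.inl (by simp)), mul_comm]
    exact hle.trans (hE v (stepEnvironment_mem hΔ σ h0))
  have hwB : π.estimateLaw w Bᶜ ≤ E := by
    rw [hBc]
    exact hE w (stepEnvironment_mem hΔ σ hx)
  -- Up to constants, making the `E^θ` term small needs `2D ≥ (1/θ) log(m-1)`. The symmetric `θ =
  -- 1/2` would need the factor `2`, while `θ = 2/3` needs only `1.5 < 1.59`.
  have key := π.exp_pow_le_estimateLaw_rpow (s := σ ^ 2) (v := v) (w := w) (δ := Δ) (θ := 2 / 3)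
    (by positivity) rfl rfl (by norm_num) (by norm_num)
    (sq_meanReward_sub_stepEnvironment_le hΔ _ hx h0) hB
  calc _ = ENNReal.ofReal (Real.exp (-(2 / 3 * (1 - 2 / 3)) *
        (Δ ^ 2 / (2 * ((σ ^ 2 : ℝ≥0) : ℝ))))) ^ T := by
        congr 3
        push_cast
        field_simp
        norm_num
    _ ≤ _ := key
    _ ≤ 1 ^ (2 / 3 : ℝ) * (E / ↑(m - 1)) ^ (1 / 3 : ℝ) + E ^ (2 / 3 : ℝ) * 1 ^ (1 / 3 : ℝ) := by
        rw [show (1 - 2 / 3 : ℝ) = 1 / 3 by norm_num]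
        gcongr
        · exact prob_le_one
        · exact prob_le_one
    _ = _ := by simp

end HardEnvironments

/-! ### Numerical comparison and conclusion -/

/-- Each summand is compared with half of the right side `u`, which after cubing asks for `b ≤
(u/2)³ (m-1)` and `b² ≤ (u/2)³`. -/
theorem rpow_add_rpow_lt_exp {D b e : ℝ} {m : ℕ} (hm : 2 ≤ m) (hD₀ : 0 ≤ D)
    (hD : 1.59 * Real.log m - 2 * Real.log 2 ≤ 2 * D)
    (hb : b = 1 / 8 * Real.exp (-D + 1 / 2 * Real.log (1 / 2 * ((m : ℝ) - 1))))
    (he₀ : 0 ≤ e) (he : e < b) :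
    (e / (m - 1)) ^ (1 / 3 : ℝ) + e ^ (2 / 3 : ℝ) < Real.exp (-(2 / 9) * D) := by
  have hm2 : (2 : ℝ) ≤ m := by exact_mod_cast hm
  set n : ℝ := (m : ℝ) - 1 with hn
  have hn1 : 1 ≤ n := by rw [hn]; linarith
  set u := Real.exp (-(2 / 9) * D) with hu
  have hu₀ : 0 < u := Real.exp_pos _
  have hb0 : 0 < b := by rw [hb]; positivity
  have hbsq : b ^ 2 = Real.exp (-(2 * D)) * n / 128 := by
    have hn2 : 0 < 1 / 2 * n := by linarith
    rw [hb, mul_pow, ← Real.exp_nat_mul]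
    push_cast
    rw [show 2 * (-D + 1 / 2 * Real.log (1 / 2 * n)) = -(2 * D) + Real.log (1 / 2 * n) by ring,
      Real.exp_add, Real.exp_log hn2]
    ring
  have hu3 : u ^ 3 = Real.exp (-(2 / 3 * D)) := by
    rw [hu, ← Real.exp_nat_mul]
    congr 1
    push_cast
    ring
  -- The budget acts here: `2/3 · 1.59 = 1.06 ≥ 1` absorbs `log n`, and the remaining `(4/3) log 2`
  -- is below `log 4`.
  have hDm : Real.exp (-(4 / 3 * D)) * n ≤ 4 := by
    have hlog : Real.log n ≤ Real.log m := Real.log_le_log (by linarith) (by linarith)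
    have hlog0 : 0 ≤ Real.log n := Real.log_nonneg hn1
    have h3 := Real.log_two_gt_d9
    have h4 : Real.log 4 = 2 * Real.log 2 := by
      rw [show (4 : ℝ) = 2 ^ 2 by norm_num, Real.log_pow]
      norm_num
    calc Real.exp (-(4 / 3 * D)) * n = Real.exp (-(4 / 3 * D) + Real.log n) := by
          rw [Real.exp_add, Real.exp_log (by linarith)]
      _ ≤ Real.exp (Real.log 4) := Real.exp_le_exp.2 (by rw [h4]; linarith)
      _ = 4 := Real.exp_log (by norm_num)
  have hbu : b ^ 2 ≤ (u / 2) ^ 3 := by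
    rw [hbsq, div_pow, hu3, show -(2 * D) = -(2 / 3 * D) + -(4 / 3 * D) by ring, Real.exp_add]
    nlinarith [Real.exp_pos (-(2 / 3 * D))]
  -- This bound needs no budget, only `D ≥ 0` and `n ≥ 1`.
  have hbn : b ≤ (u / 2) ^ 3 * n := by
    rw [← pow_le_pow_iff_left₀ hb0.le (by positivity) two_ne_zero, hbsq, mul_pow, div_pow, hu3,
      div_pow, ← Real.exp_nat_mul, show -(2 * D) = -(2 / 3 * D) + -(4 / 3 * D) by ring,
      Real.exp_add, show ((2 : ℕ) : ℝ) * -(2 / 3 * D) = -(4 / 3 * D) by push_cast; ring]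
    have h1 : Real.exp (-(2 / 3 * D)) ≤ 1 := Real.exp_le_one_iff.2 (by linarith)
    have h2 : Real.exp (-(2 / 3 * D)) * n ≤ n ^ 2 := by nlinarith
    have h3 := mul_le_mul_of_nonneg_left h2 (Real.exp_pos (-(4 / 3 * D))).le
    nlinarith [mul_nonneg (Real.exp_pos (-(4 / 3 * D))).le (sq_nonneg n)]
  have hcube : ((u / 2) ^ 3) ^ (1 / 3 : ℝ) = u / 2 := by
    have := Real.pow_rpow_inv_natCast (x := u / 2) (n := 3) (by positivity) (by norm_num)
    rwa [show (((3 : ℕ) : ℝ)⁻¹) = 1 / 3 by norm_num] at this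
  have h1 : (e / n) ^ (1 / 3 : ℝ) ≤ u / 2 := by
    rw [← hcube]
    refine Real.rpow_le_rpow (by positivity) ?_ (by norm_num)
    rw [div_le_iff₀ (by linarith)]
    exact he.le.trans hbn
  have h2 : e ^ (2 / 3 : ℝ) < u / 2 := by
    rw [← hcube, show (2 / 3 : ℝ) = (2 : ℕ) * (1 / 3) by norm_num, Real.rpow_mul he₀,
      Real.rpow_natCast]
    refine Real.rpow_lt_rpow (by positivity) (lt_of_lt_of_le ?_ hbu) (by norm_num)
    exact pow_lt_pow_left₀ he he₀ two_ne_zero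
  linarith

end PiecewiseConstantBandit

theorem theorem2 (T : ℕ) (Δ η : ℝ) (σ : ℝ≥0) (hΔ : 0 < Δ) (hσ : 0 < σ)
    (hη₀ : 0 < η) (hη : η ≤ 1 / 4)
    (hT : PiecewiseConstantBandit.budgetThreshold Δ σ η ≤ (T : ℝ)) :
    ENNReal.ofReal (1 / 8 * Real.exp (-(Δ ^ 2 / (2 * (σ : ℝ) ^ 2)) * (T : ℝ)
        + 1 / 2 * Real.log (1 / 2 * ((⌊1 / (2 * η)⌋₊ : ℝ) - 1))))
      ≤ ⨅ π : PiecewiseConstantBandit.Policy T,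
          ⨆ v ∈ PiecewiseConstantBandit.gaussianEnvironments Δ σ, π.failureProb v η := by
  refine le_iInf fun π => ?_
  set m := ⌊1 / (2 * η)⌋₊ with hmdef
  -- The tolerance `η ≤ 1/4` leaves at least one alternative to the change point `0`.
  have hm : 2 ≤ m := Nat.le_floor (by rw [le_div_iff₀ (by positivity)]; push_cast; linarith)
  have hm' : (m : ℝ) * (2 * η) ≤ 1 := by
    rw [← le_div_iff₀ (by positivity)]
    exact Nat.floor_le (by positivity)
  set E := ⨆ v ∈ PiecewiseConstantBandit.gaussianEnvironments Δ σ, π.failureProb v η with hE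
  have key := PiecewiseConstantBandit.exp_pow_le_of_failureProb_le π hΔ hσ hη₀ hm hm' (E := E)
    fun v hv => le_iSup₂_of_le v hv le_rfl
  by_contra! hlt
  have hEtop : E ≠ ⊤ := hlt.ne_top
  have hσ' : (0 : ℝ) < σ := hσ
  have hm1 : (0 : ℝ) < (m : ℝ) - 1 := by
    have : (2 : ℝ) ≤ m := by exact_mod_cast hm
    linarith
  rw [← ENNReal.ofReal_toReal hEtop] at hlt key
  rw [ENNReal.ofReal_lt_ofReal_iff (by positivity)] at hlt
  set e := E.toReal with he
  have he₀ : 0 ≤ e := ENNReal.toReal_nonneg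
  have hD : 1.59 * Real.log m - 2 * Real.log 2 ≤ 2 * (Δ ^ 2 / (2 * (σ : ℝ) ^ 2) * T) := by
    rw [PiecewiseConstantBandit.budgetThreshold, ← hmdef, div_mul_eq_mul_div,
      div_le_iff₀ (by positivity)] at hT
    rw [← mul_le_mul_iff_right₀ (show (0 : ℝ) < (σ : ℝ) ^ 2 by positivity)]
    refine hT.trans (le_of_eq ?_)
    field_simp
  have hcon := PiecewiseConstantBandit.rpow_add_rpow_lt_exp hm (by positivity) hD rfl he₀
    (by rw [← neg_mul]; exact hlt)
  have hcast : ((m - 1 : ℕ) : ℝ≥0∞) = ENNReal.ofReal ((m : ℝ) - 1) := by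
    rw [← ENNReal.ofReal_natCast, Nat.cast_sub (by omega)]
    simp
  rw [hcast, ← ENNReal.ofReal_div_of_pos hm1,
    ENNReal.ofReal_rpow_of_nonneg (by positivity) (by norm_num),
    ENNReal.ofReal_rpow_of_nonneg he₀ (by norm_num), ← ENNReal.ofReal_add (by positivity)
      (by positivity), ← ENNReal.ofReal_pow (by positivity), ENNReal.ofReal_le_ofReal_iff
      (by positivity), ← Real.exp_nat_mul] at key
  refine absurd hcon (not_lt.2 (le_trans (le_of_eq ?_) key))
  congr 1
  field_simp
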